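/- Let $E$ and $F$ be finite-dimensional real vector spaces, with $E^*$ and $F^*$ their dual spaces, and let $E_+ \subseteq E$ and $F_+ \subseteq F$ be convex cones (non-empty subsets closed under addition and under multiplication by non-negative scalars) that are closed, proper ($E_+ \cap -E_+ = \{0\}$ and $F_+ \cap -F_+ = \{0\}$) and generating ($E_+ - E_+ = E$ and $F_+ - F_+ = F$). Assume that $\dim(E) \geq \dim(F)$, and that $E_+$ is strictly convex (every non-zero boundary point $x$ of $E_+$ is an extremal direction, i.e. whenever $x = y + z$ with $y, z \in E_+$, both $y$ and $z$ are non-negative multiples of $x$) or smooth (at every non-zero boundary point, $E_+$ has exactly one supporting hyperplane). Let $$E_+ \otimes_{\pi} F_+ := \Big\{ \sum_{i=1}^k x_i \otimes y_i \,:\, k \in \mathbb{N},\ x_1,\ldots,x_k \in E_+,\ y_1,\ldots,y_k \in F_+ \Big\} \subseteq E \otimes F$$ be the projective cone, and let $$E_+ \otimes_{\varepsilon} F_+ := \big\{ u \in E \otimes F \,:\, \langle u, \varphi \otimes \psi \rangle \geq 0 \text{ for all } \varphi \in E_+^*,\ \psi \in F_+^* \big\}$$ be the injective cone, where $E_+^*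 := \{\varphi \in E^* : \varphi(x) \geq 0 \text{ for all } x \in E_+\}$ and $F_+^* := \{\psi \in F^* : \psi(y) \geq 0 \text{ for all } y \in F_+\}$ are the dual cones. Then $E_+ \otimes_{\pi} F_+ = E_+ \otimes_{\varepsilon} F_+$ if and only if $F_+$ is a simplex cone, i.e. $F_+$ is the convex cone generated by some basis of $F$. -/

import Mathlib

namespace PointedCone

section Geometry

variable {E : Type*} [AddCommGroup E] [Module ℝ E]

/-- `C` is a *simplex cone* (Yudin cone): it is generated, as a convex cone, by a (finite) basis
of the ambient space. -/
def IsSimplexCone (C : PointedCone ℝ E) : Prop :=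
  ∃ (n : ℕ) (b : Module.Basis (Fin n) ℝ E), C = PointedCone.hull ℝ (Set.range b)

/-- `x` is an *extremal direction* of `C`: a non-zero element of `C` such that in every
decomposition `x = y + z` with `y, z ∈ C` the summands are non-negative multiples of `x`. -/
def IsExtremalDirection (C : PointedCone ℝ E) (x : E) : Prop :=
  x ∈ C ∧ x ≠ 0 ∧ ∀ y ∈ C, ∀ z ∈ C, y + z = x → ∃ c : ℝ, 0 ≤ c ∧ y = c • x

/-- `H` is a *supporting hyperplane* of `C` at `x`: an (affine) hyperplane through `x` such that
`C` lies in one of the two closed half-spaces bounded by `H`. -/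
def IsSupportingHyperplaneAt (C : PointedCone ℝ E) (x : E) (H : Set E) : Prop :=
  ∃ φ : Module.Dual ℝ E, φ ≠ 0 ∧ (∀ y ∈ C, φ x ≤ φ y) ∧ H = {y | φ y = φ x}

variable [TopologicalSpace E]

/-- A (closed, proper and generating) cone is *strictly convex* if every non-zero boundary point
is an extremal direction. -/
def IsStrictlyConvexCone (C : PointedCone ℝ E) : Prop :=
  ∀ x ∈ frontier (C : Set E), x ≠ 0 → C.IsExtremalDirection x

/-- A (closed, proper and generating) cone is *smooth* if every non-zero boundary point has
exactly one supporting hyperplane. -/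
def IsSmoothCone (C : PointedCone ℝ E) : Prop :=
  ∀ x ∈ frontier (C : Set E), x ≠ 0 → ∃! H : Set E, C.IsSupportingHyperplaneAt x H

end Geometry

end PointedCone

set_option linter.unusedSectionVars false

section TensorProductsOfCones

open Module Topology Filter TensorProduct

/-! ### Positive maps of maximal determinant. -/

section Core

variable {V W : Type*} [NormedAddCommGroup V] [NormedSpace ℝ V] [FiniteDimensional ℝ V]
  [NormedAddCommGroup W] [NormedSpace ℝ W] [FiniteDimensional ℝ W]

/-! Tensors in `E ⊗ F` are linear maps `F* → E`, and the injective cone consists of those sending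
the dual cone of `F` into the cone of `E`. Suppose the two tensor cones agree and `E` carries the
strictly convex cone. It is enough to find an injective positive map `u : F* → E` and a basis `b` of
`F*`, taken from the dual cone, with every `u (b j)` on the boundary, hence extremal. Write the
tensor of `u` as `∑ x i ⊗ y i` with positive factors. Contracting with `b j` exhibits `u (b j)` as a
sum of the positive terms `b j (y i) • x i`, so extremality makes each nonzero term a multiple of `u
(b j)`. Since `u` is injective, a nonzero `x i` serves only one `j`, and `y i` is then a multiple of
the predual vector `e j`. So all `e j` are positive, and since the `b j` are positive too, the cone
of `F` is generated by `e` (`isSimplexCone_of_isStrictlyConvexCone`).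

The map `u` comes from an extremal problem in the spirit of John's ellipsoid theorem: compose
positive maps with a fixed surjection `p` back to the source and maximise the absolute determinant
on a compact slice. If the vectors sent to the boundary did not span, some functional `g ≠ 0` would
kill them, and perturbations along `g` in both directions would remain admissible to first order.
Criticality then forces `g` to be a multiple of `φ ∘ u`, which is impossible in dimension above one
(`first_order_of_isMax_det`, `exists_positive_injective_span_eq_top`). In dimension at most one
every such cone is a simplex cone.

In the smooth case everything is dualised: the dual cone is strictly convex, equality of the tensor
cones passes to the duals, and a closed cone with simplex dual is a simplex cone. The converse
implication is the known statement for simplicial cones. -/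

theorem LinearMap.trace_nonpos_of_det_le_one {V : Type*} [AddCommGroup V] [Module ℝ V]
    [FiniteDimensional ℝ V] (A : V →ₗ[ℝ] V)
    (h : ∀ᶠ t : ℝ in 𝓝[>] 0, LinearMap.det (1 + t • A) ≤ 1) : LinearMap.trace ℝ V A ≤ 0 := by
  classical
  set b := Module.finBasis ℝ V
  set M := LinearMap.toMatrix b b A
  set q := (1 + (Polynomial.X : Polynomial ℝ) • M.map ⇑Polynomial.C).det.divX.divX
  -- The trace is the linear coefficient of the determinant, so a positive trace would push the
  -- determinant above 1 for small `t > 0`.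
  have key (t : ℝ) : LinearMap.det (1 + t • A) = 1 + M.trace * t + q.eval t * t ^ 2 := by
    rw [← LinearMap.det_toMatrix b, ← Matrix.det_one_add_smul, map_add, map_smul,
      LinearMap.toMatrix_one]
  rw [LinearMap.trace_eq_matrix_trace ℝ b]
  by_contra! hpos
  change 0 < M.trace at hpos
  have hlim : Tendsto (fun t : ℝ => M.trace + q.eval t * t) (𝓝[>] 0) (𝓝 M.trace) := by
    have : Continuous fun t : ℝ => M.trace + q.eval t * t := by fun_prop
    simpa using (this.tendsto 0).mono_left nhdsWithin_le_nhds
  obtain ⟨t, ⟨h1, h2⟩, h3⟩ :=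
    ((h.and (hlim.eventually (lt_mem_nhds hpos))).and self_mem_nhdsWithin).exists
  rw [key] at h1
  have h3 : (0 : ℝ) < t := h3
  nlinarith [mul_pos h2 h3]

namespace PointedCone

theorem isCompact_slice {C : PointedCone ℝ V} (hC : IsClosed (C : Set V)) (f : V →ₗ[ℝ] ℝ)
    (hf : ∀ x ∈ C, x ≠ 0 → 0 < f x) : IsCompact {x | x ∈ C ∧ f x = 1} := by
  have hfc : Continuous f := f.continuous_of_finiteDimensional
  have hcl : IsClosed {x | x ∈ C ∧ f x = 1} := hC.inter (isClosed_eq hfc continuous_const)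
  have hK : IsCompact (Metric.sphere (0 : V) 1 ∩ C) := (isCompact_sphere 0 1).inter_right hC
  obtain ⟨r, hr, hrK⟩ : ∃ r > 0, ∀ x ∈ Metric.sphere (0 : V) 1 ∩ C, r ≤ f x := by
    rcases (Metric.sphere (0 : V) 1 ∩ C).eq_empty_or_nonempty with h | h
    · exact ⟨1, one_pos, by simp [h]⟩
    · obtain ⟨x, hx, hmin⟩ := hK.exists_isMinOn h hfc.continuousOn
      refine ⟨f x, hf x hx.2 ?_, fun y hy => hmin hy⟩
      rintro rfl
      simpa using hx.1
  refine Metric.isCompact_of_isClosed_isBounded hcl ?_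
  rw [isBounded_iff_forall_norm_le]
  refine ⟨1 / r, fun x ⟨hx, hx1⟩ => ?_⟩
  have hx0 : x ≠ 0 := by rintro rfl; simp at hx1
  have hn : 0 < ‖x‖ := norm_pos_iff.2 hx0
  have h := hrK (‖x‖⁻¹ • x) ⟨by simp [norm_smul, hn.ne'], C.smul_mem (by positivity) hx⟩
  rw [map_smul, hx1, smul_eq_mul, mul_one] at h
  rw [le_div_iff₀ hr]
  calc ‖x‖ * r ≤ ‖x‖ * ‖x‖⁻¹ := by gcongr
    _ = 1 := mul_inv_cancel₀ hn.ne'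

/-- The cone of continuous linear maps that send `C` into `D`. -/
def positiveMaps (C : PointedCone ℝ V) (D : PointedCone ℝ W) : PointedCone ℝ (V →L[ℝ] W) where
  carrier := {u | ∀ c ∈ C, u c ∈ D}
  zero_mem' _ _ := D.zero_mem
  add_mem' hu hv c hc := D.add_mem (hu c hc) (hv c hc)
  smul_mem' r _ hu c hc := Submodule.smul_mem D r (hu c hc)

theorem mem_positiveMaps {C : PointedCone ℝ V} {D : PointedCone ℝ W} {u : V →L[ℝ] W} :
    u ∈ positiveMaps C D ↔ ∀ c ∈ C, u c ∈ D := .rfl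

theorem isClosed_positiveMaps (C : PointedCone ℝ V) {D : PointedCone ℝ W}
    (hD : IsClosed (D : Set W)) : IsClosed (positiveMaps C D : Set (V →L[ℝ] W)) := by
  have : (positiveMaps C D : Set (V →L[ℝ] W)) = ⋂ c ∈ C, (fun u : V →L[ℝ] W => u c) ⁻¹' D := by
    ext u; simp [mem_positiveMaps]
  rw [this]
  exact isClosed_biInter fun c _ => hD.preimage (ContinuousLinearMap.apply ℝ W c).continuous

/-- At slice points mapped to the interior, openness absorbs a small perturbation. At those mapped
to the frontier, `g` vanishes, so the perturbation is close to the interior point `w₀` and adding it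
stays in `D`. Compactness of the slice `f = 1` gives one `t` for all points. -/
theorem eventually_perturbation_mem {C : PointedCone ℝ V} {D : PointedCone ℝ W}
    (hC : IsClosed (C : Set V)) {f : V →ₗ[ℝ] ℝ} (hf : ∀ x ∈ C, x ≠ 0 → 0 < f x)
    {u : V →L[ℝ] W} (hu : u ∈ positiveMaps C D) {g : V →ₗ[ℝ] ℝ}
    (hg : ∀ c ∈ C, u c ∈ frontier (D : Set W) → g c = 0) (w : W) {w₀ : W}
    (hw₀ : w₀ ∈ interior (D : Set W)) :
    ∃ t : ℝ, 0 < t ∧ u + t • (g.smulRight w + f.smulRight w₀).toContinuousLinearMap ∈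
      positiveMaps C D := by
  have hfc : Continuous f := f.continuous_of_finiteDimensional
  have hgc : Continuous g := g.continuous_of_finiteDimensional
  have key : ∀ᶠ t : ℝ in 𝓝 0, ∀ c ∈ {x | x ∈ C ∧ f x = 1},
      0 < t → c ∈ C → u c + t • (g c • w + f c • w₀) ∈ D := by
    refine (isCompact_slice hC f hf).eventually_forall_of_forall_eventually fun c ⟨hc, hfc1⟩ => ?_
    by_cases hint : u c ∈ interior (D : Set W)
    · have hcont : Continuous fun z : ℝ × V => u z.2 + z.1 • (g z.2 • w + f z.2 • w₀) := by
        fun_prop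
      have h0 := hcont.tendsto (0, c)
      simp only [zero_smul, add_zero] at h0
      filter_upwards [h0.eventually (isOpen_interior.mem_nhds hint)] with z hz _ _
      exact interior_subset hz
    · have hgc0 := hg c hc ⟨subset_closure (hu c hc), hint⟩
      have hcont : Continuous fun z : ℝ × V => g z.2 • w + f z.2 • w₀ := by fun_prop
      have h0 := hcont.tendsto (0, c)
      simp only [hgc0, hfc1, zero_smul, zero_add, one_smul] at h0
      filter_upwards [h0.eventually (isOpen_interior.mem_nhds hw₀)] with z hz hz0 hzC
      exact D.add_mem (hu _ hzC) (D.smul_mem hz0.le (interior_subset hz))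
  obtain ⟨t, ht, ht0⟩ := ((key.filter_mono nhdsWithin_le_nhds).and
    (self_mem_nhdsWithin : Set.Ioi (0 : ℝ) ∈ 𝓝[>] 0)).exists
  refine ⟨t, ht0, fun c hc => ?_⟩
  rcases eq_or_ne c 0 with rfl | hc0
  · simp
  have hfp := hf c hc hc0
  have h := D.smul_mem hfp.le (ht ((f c)⁻¹ • c)
    ⟨C.smul_mem (by positivity) hc, by simp [hfp.ne']⟩ ht0 (C.smul_mem (by positivity) hc))
  convert h using 1
  have h1 : f c * (f c)⁻¹ = 1 := mul_inv_cancel₀ hfp.ne'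
  have h2 (a : ℝ) : f c * (t * ((f c)⁻¹ * a)) = t * a := by
    rw [show f c * (t * ((f c)⁻¹ * a)) = (f c * (f c)⁻¹) * (t * a) by ring, h1, one_mul]
  simp only [map_smul, smul_add, smul_smul, smul_eq_mul, h1, h2, one_smul]
  simp [smul_smul]

/-- If the value were 0 then `v c₀ = 0`. Since `c₀ ± s • x` lies in `C` for small `s`, both `v x`
and its negative would lie in `D`, forcing `v x = 0`. -/
theorem apply_pos_of_mem_positiveMaps {C : PointedCone ℝ V} {D : PointedCone ℝ W}
    {c₀ : V} (hc₀ : c₀ ∈ interior (C : Set V))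
    {φ : W →ₗ[ℝ] ℝ} (hφ : ∀ x ∈ D, x ≠ 0 → 0 < φ x)
    {v : V →L[ℝ] W} (hv : v ∈ positiveMaps C D) (hv0 : v ≠ 0) : 0 < φ (v c₀) := by
  have hφ0 : ∀ x ∈ D, 0 ≤ φ x := fun x hx => by
    rcases eq_or_ne x 0 with rfl | h
    · simp
    · exact (hφ x hx h).le
  refine hφ _ (hv _ (interior_subset hc₀)) fun h0 => hv0 ?_
  ext x
  have hline : Tendsto (fun s : ℝ => c₀ + s • x) (𝓝 0) (𝓝 c₀) := by
    have : Continuous fun s : ℝ => c₀ + s • x := by fun_prop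
    simpa using this.tendsto 0
  have hev : ∀ᶠ s : ℝ in 𝓝 0, c₀ + s • x ∈ C :=
    hline.eventually (mem_interior_iff_mem_nhds.1 hc₀)
  have hev' := (continuous_neg.tendsto' (0 : ℝ) 0 neg_zero).eventually hev
  obtain ⟨s, ⟨h1, h2⟩, hs⟩ := (((hev.and hev').filter_mono nhdsWithin_le_nhds).and
    (self_mem_nhdsWithin : Set.Ioi (0 : ℝ) ∈ 𝓝[>] 0)).exists
  have hs : 0 < s := hs
  have h1 := hv _ h1
  have h2 := hv _ h2
  rw [map_add, map_smul, h0, zero_add] at h1 h2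
  by_contra hne
  have h3 := hφ _ h1 (smul_ne_zero hs.ne' hne)
  have h4 := hφ0 _ h2
  rw [neg_smul, map_neg] at h4
  linarith

theorem exists_mem_positiveMaps_det_ne_zero {C : PointedCone ℝ V} {D : PointedCone ℝ W}
    (hC : IsClosed (C : Set V)) {f : V →ₗ[ℝ] ℝ} (hf : ∀ x ∈ C, x ≠ 0 → 0 < f x)
    {w₀ : W} (hw₀ : w₀ ∈ interior (D : Set W))
    (p : W →L[ℝ] V) (hp : Function.Surjective p) :
    ∃ v ∈ positiveMaps C D, (p ∘L v).det ≠ 0 := by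
  -- The map will be `f ⊗ w₀ + r • j`. Composed with `p` it is a rank-one perturbation of `r • id`,
  -- invertible unless `r = 0` or `r = -f (p w₀)`; a small `r` keeps it positive.
  obtain ⟨j, hj⟩ := p.toLinearMap.exists_rightInverse_of_surjective (LinearMap.range_eq_top.2 hp)
  have hpj (x : V) : p (j x) = x := LinearMap.congr_fun hj x
  obtain ⟨r, hr0, hrne, hr⟩ : ∃ r : ℝ, 0 < r ∧ r ≠ -f (p w₀) ∧
      ∀ c ∈ {x | x ∈ C ∧ f x = 1}, w₀ + r • j c ∈ D := by
    have key : ∀ᶠ r : ℝ in 𝓝 0, ∀ c ∈ {x | x ∈ C ∧ f x = 1}, w₀ + r • j c ∈ D := by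
      refine (isCompact_slice hC f hf).eventually_forall_of_forall_eventually fun c _ => ?_
      have hjc : Continuous j := j.continuous_of_finiteDimensional
      have hcont : Continuous fun z : ℝ × V => w₀ + z.1 • j z.2 := by fun_prop
      have h0 := hcont.tendsto (0, c)
      simp only [zero_smul, add_zero] at h0
      exact h0.eventually (mem_interior_iff_mem_nhds.1 hw₀)
    have hne : ∀ᶠ r : ℝ in 𝓝[>] 0, r ≠ -f (p w₀) := by
      rcases le_or_gt (-f (p w₀)) 0 with h | h
      · filter_upwards [self_mem_nhdsWithin] with r hr using (h.trans_lt hr).ne'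
      · exact (eventually_ne_nhds h.ne).filter_mono nhdsWithin_le_nhds
    obtain ⟨r, ⟨h1, h2⟩, h3⟩ := (((key.filter_mono nhdsWithin_le_nhds).and hne).and
      (self_mem_nhdsWithin : Set.Ioi (0 : ℝ) ∈ 𝓝[>] 0)).exists
    exact ⟨r, h3, h2, h1⟩
  let v : V →L[ℝ] W := (f.smulRight w₀ + r • j).toContinuousLinearMap
  have hv_apply (x : V) : v x = f x • w₀ + r • j x := rfl
  refine ⟨v, fun c hc => ?_, fun h0 => ?_⟩
  · rcases eq_or_ne c 0 with rfl | hc0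
    · simp
    have hfp := hf c hc hc0
    have h := D.smul_mem hfp.le (hr ((f c)⁻¹ • c)
      ⟨C.smul_mem (by positivity) hc, by simp [hfp.ne']⟩)
    have h1 : f c * r * (f c)⁻¹ = r := by field_simp
    rw [map_smul, smul_add, smul_smul, smul_smul, h1] at h
    exact h
  · have h0 : LinearMap.det ((p ∘L v : V →L[ℝ] V) : V →ₗ[ℝ] V) = 0 := h0
    rw [LinearMap.det_eq_zero_iff_ker_ne_bot] at h0
    refine h0 (LinearMap.ker_eq_bot'.2 fun x hx => ?_)
    have hx : f x • p w₀ + r • x = 0 := by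
      have : p (v x) = 0 := hx
      rwa [hv_apply, map_add, map_smul, map_smul, hpj] at this
    have h1 : f x * (f (p w₀) + r) = 0 := by
      have := congrArg f hx
      simp only [map_add, map_smul, smul_eq_mul, map_zero] at this
      linarith
    have h2 : f (p w₀) + r ≠ 0 := fun h => hrne (by linarith)
    have h3 : f x = 0 := (mul_eq_zero.1 h1).resolve_right h2
    rw [h3, zero_smul, zero_add] at hx
    exact (smul_eq_zero.1 hx).resolve_left hr0.ne'

theorem exists_mem_positiveMaps_isMax_det [Nontrivial V]
    {C : PointedCone ℝ V} {D : PointedCone ℝ W}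
    (hC : IsClosed (C : Set V)) (hD : IsClosed (D : Set W))
    {f : V →ₗ[ℝ] ℝ} (hf : ∀ x ∈ C, x ≠ 0 → 0 < f x)
    {c₀ : V} (hc₀ : c₀ ∈ interior (C : Set V))
    {φ : W →ₗ[ℝ] ℝ} (hφ : ∀ x ∈ D, x ≠ 0 → 0 < φ x)
    {w₀ : W} (hw₀ : w₀ ∈ interior (D : Set W))
    (p : W →L[ℝ] V) (hp : Function.Surjective p) :
    ∃ u ∈ positiveMaps C D, φ (u c₀) = 1 ∧ (p ∘L u).det ≠ 0 ∧
      ∀ v ∈ positiveMaps C D, φ (v c₀) = 1 → |(p ∘L v).det| ≤ |(p ∘L u).det| := by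
  let ℓ : (V →L[ℝ] W) →ₗ[ℝ] ℝ := φ ∘ₗ (ContinuousLinearMap.apply ℝ W c₀ : (V →L[ℝ] W) →ₗ[ℝ] W)
  have hℓ (v : V →L[ℝ] W) : ℓ v = φ (v c₀) := rfl
  have hcomp : IsCompact {v | v ∈ positiveMaps C D ∧ ℓ v = 1} := by
    refine isCompact_slice (V := V →L[ℝ] W) (C := positiveMaps C D) ?_ ℓ ?_
    · exact isClosed_positiveMaps C hD
    · intro v hv hv0
      rw [hℓ]
      exact apply_pos_of_mem_positiveMaps hc₀ hφ hv hv0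
  obtain ⟨v, hvK, hvdet⟩ := exists_mem_positiveMaps_det_ne_zero hC hf hw₀ p hp
  have hsmul (r : ℝ) : (p ∘L (r • v)).det = r ^ finrank ℝ V * (p ∘L v).det := by
    rw [ContinuousLinearMap.comp_smul, ContinuousLinearMap.det, ContinuousLinearMap.toLinearMap_smul,
      LinearMap.det_smul]
  have hv0 : v ≠ 0 := by
    rintro rfl
    apply hvdet
    have := hsmul 0
    rwa [zero_smul, zero_pow finrank_pos.ne', zero_mul] at this
  have hℓv : 0 < ℓ v := by
    rw [hℓ]
    exact apply_pos_of_mem_positiveMaps hc₀ hφ hvK hv0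
  have hscaled : (ℓ v)⁻¹ • v ∈ {x | x ∈ positiveMaps C D ∧ ℓ x = 1} := by
    refine ⟨(positiveMaps C D).smul_mem (inv_nonneg.2 hℓv.le) hvK, ?_⟩
    rw [map_smul, smul_eq_mul, inv_mul_cancel₀ hℓv.ne']
  have hcont : Continuous fun u : V →L[ℝ] W => |(p ∘L u).det| :=
    (ContinuousLinearMap.continuous_det.comp
      ((ContinuousLinearMap.compL ℝ V W V p).continuous)).abs
  obtain ⟨u, ⟨huK, hu1⟩, hmax⟩ := hcomp.exists_isMaxOn ⟨_, hscaled⟩ hcont.continuousOn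
  have hmax' : ∀ w ∈ positiveMaps C D, φ (w c₀) = 1 → |(p ∘L w).det| ≤ |(p ∘L u).det| :=
    fun w hw hw1 => isMaxOn_iff.1 hmax w ⟨hw, (hℓ w).trans hw1⟩
  refine ⟨u, huK, (hℓ u).symm.trans hu1, fun h0 => ?_, hmax'⟩
  have h1 := hmax' _ hscaled.1 ((hℓ _).symm.trans hscaled.2)
  rw [h0, abs_zero, abs_nonpos_iff, hsmul] at h1
  exact mul_ne_zero (pow_ne_zero _ (inv_ne_zero hℓv.ne')) hvdet h1

/-- A positive map of maximal determinant satisfies a one-sided first-order condition in the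
directions `g ⊗ w` for which `g` vanishes on the vectors mapped to the boundary. -/
theorem first_order_of_isMax_det {C : PointedCone ℝ V} {D : PointedCone ℝ W}
    (hC : IsClosed (C : Set V))
    {f : V →ₗ[ℝ] ℝ} (hf : ∀ x ∈ C, x ≠ 0 → 0 < f x) {c₀ : V} {φ : W →ₗ[ℝ] ℝ}
    {w₀ : W} (hw₀ : w₀ ∈ interior (D : Set W)) (p : W →L[ℝ] V)
    {u : V →L[ℝ] W} (hu : u ∈ positiveMaps C D) (hu1 : φ (u c₀) = 1)
    (hmax : ∀ v ∈ positiveMaps C D, φ (v c₀) = 1 → |(p ∘L v).det| ≤ |(p ∘L u).det|)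
    (T : V ≃ₗ[ℝ] V) (hT : ∀ x, T x = p (u x)) {g : V →ₗ[ℝ] ℝ}
    (hg : ∀ c ∈ C, u c ∈ frontier (D : Set W) → g c = 0) (w : W) :
    g (T.symm (p w)) ≤ finrank ℝ V * (g c₀ * φ w) := by
  have key (δ : ℝ) (hδ : 0 < δ) : g (T.symm (p w)) + δ * f (T.symm (p w₀)) ≤
      finrank ℝ V * (g c₀ * φ w + δ * (f c₀ * φ w₀)) := by
    obtain ⟨t₁, ht₁, hmem⟩ := eventually_perturbation_mem (f := δ • f) hC
      (fun x hx hx0 => mul_pos hδ (hf x hx hx0)) hu hg w hw₀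
    set h := (g.smulRight w + (δ • f).smulRight w₀).toContinuousLinearMap with hh
    set l := φ (h c₀) with hl
    have hl' : l = g c₀ * φ w + δ * (f c₀ * φ w₀) := by
      simp [hl, hh, mul_assoc]
    -- Subtracting `l • u` makes the direction tangent to the normalisation `φ (v c₀) = 1`.
    set A : V →ₗ[ℝ] V := T.symm.toLinearMap ∘ₗ (p ∘L (h - l • u) : V →L[ℝ] V).toLinearMap with hA
    have hdet (t : ℝ) : (p ∘L (u + t • (h - l • u))).det =
        LinearMap.det T.toLinearMap * LinearMap.det (1 + t • A) := by
      rw [← LinearMap.det_comp]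
      change LinearMap.det (p ∘L (u + t • (h - l • u)) : V →L[ℝ] V).toLinearMap = _
      congr 1
      ext x
      simp [hA, ← hT]
    have hdetT : LinearMap.det T.toLinearMap ≠ 0 := T.isUnit_det'.ne_zero
    have hev : ∀ᶠ t : ℝ in 𝓝[>] 0, LinearMap.det (1 + t • A) ≤ 1 := by
      have hsmall : Tendsto (fun t : ℝ => t * (l + t₁⁻¹)) (𝓝[>] 0) (𝓝 0) := by
        have : Continuous fun t : ℝ => t * (l + t₁⁻¹) := by fun_prop
        simpa using (this.tendsto 0).mono_left nhdsWithin_le_nhds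
      filter_upwards [hsmall.eventually (gt_mem_nhds one_pos), self_mem_nhdsWithin] with t ht ht0
      have ht0 : 0 < t := ht0
      have hmem' : u + t • (h - l • u) ∈ positiveMaps C D := by
        -- The perturbed map is a non-negative combination of `u` and `u + t₁ • h`.
        have h1 := (positiveMaps C D).add_mem
          ((positiveMaps C D).smul_mem (show 0 ≤ 1 - t * (l + t₁⁻¹) by linarith) hu)
          ((positiveMaps C D).smul_mem (show 0 ≤ t * t₁⁻¹ by positivity) hmem)
        convert h1 using 1
        rw [smul_add, smul_smul, show t * t₁⁻¹ * t₁ = t by field_simp]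
        module
      have h2 := hmax _ hmem' (by
        simp only [add_apply, smul_apply, sub_apply, map_add, map_smul, map_sub, hu1, smul_eq_mul,
          ← hl]
        ring)
      have h3 : (p ∘L u).det = LinearMap.det T.toLinearMap := by
        simpa using hdet 0
      rw [hdet, h3, abs_mul] at h2
      exact (le_abs_self _).trans (le_of_mul_le_mul_left (by simpa using h2) (abs_pos.2 hdetT))
    have htr := A.trace_nonpos_of_det_le_one hev
    have hA' : A = g.smulRight (T.symm (p w)) + δ • f.smulRight (T.symm (p w₀)) -
        l • LinearMap.id := by
      ext x
      simp [hA, hh, ← hT, smul_smul]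
    rw [hA', map_sub, map_add, map_smul, map_smul, LinearMap.trace_smulRight,
      LinearMap.trace_smulRight, LinearMap.trace_id, hl'] at htr
    simp only [smul_eq_mul] at htr
    linarith
  have hlim1 : Tendsto (fun δ : ℝ => g (T.symm (p w)) + δ * f (T.symm (p w₀))) (𝓝[>] 0)
      (𝓝 (g (T.symm (p w)))) := by
    have : Continuous fun δ : ℝ => g (T.symm (p w)) + δ * f (T.symm (p w₀)) := by fun_prop
    simpa using (this.tendsto 0).mono_left nhdsWithin_le_nhds
  have hlim2 : Tendsto (fun δ : ℝ => (finrank ℝ V : ℝ) * (g c₀ * φ w + δ * (f c₀ * φ w₀)))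
      (𝓝[>] 0) (𝓝 (finrank ℝ V * (g c₀ * φ w))) := by
    have : Continuous fun δ : ℝ => (finrank ℝ V : ℝ) * (g c₀ * φ w + δ * (f c₀ * φ w₀)) := by
      fun_prop
    simpa using (this.tendsto 0).mono_left nhdsWithin_le_nhds
  exact le_of_tendsto_of_tendsto hlim1 hlim2
    (eventually_nhdsWithin_of_forall fun δ hδ => key δ hδ)

theorem exists_positive_injective_span_eq_top {C : PointedCone ℝ V} {D : PointedCone ℝ W}
    (hC : IsClosed (C : Set V)) (hD : IsClosed (D : Set W))
    {f : V →ₗ[ℝ] ℝ} (hf : ∀ x ∈ C, x ≠ 0 → 0 < f x) (hCint : (interior (C : Set V)).Nonempty)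
    {φ : W →ₗ[ℝ] ℝ} (hφ : ∀ x ∈ D, x ≠ 0 → 0 < φ x) (hDint : (interior (D : Set W)).Nonempty)
    (hdim : finrank ℝ V ≤ finrank ℝ W) (hV : 1 < finrank ℝ V) :
    ∃ u : V →ₗ[ℝ] W, Function.Injective u ∧ (∀ c ∈ C, u c ∈ D) ∧
      Submodule.span ℝ {c | c ∈ C ∧ u c ∈ frontier (D : Set W)} = ⊤ := by
  have : Nontrivial V := nontrivial_of_finrank_pos (zero_lt_one.trans hV)
  obtain ⟨c₀, hc₀⟩ := hCint
  obtain ⟨w₀, hw₀⟩ := hDint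
  obtain ⟨j, hj⟩ := finrank_le_iff_exists_linearMap.1 hdim
  obtain ⟨p, hp⟩ := j.exists_leftInverse_of_injective (LinearMap.ker_eq_bot.2 hj)
  have hps : Function.Surjective p := fun x => ⟨j x, LinearMap.congr_fun hp x⟩
  obtain ⟨u, hu, hu1, hudet, hmax⟩ := exists_mem_positiveMaps_isMax_det hC hD hf hc₀ hφ hw₀
    p.toContinuousLinearMap hps
  let T : V ≃ₗ[ℝ] V := LinearEquiv.ofIsUnitDet (v := finBasis ℝ V) (v' := finBasis ℝ V)
    (f := (p.toContinuousLinearMap ∘L u : V →L[ℝ] V).toLinearMap)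
    (by rw [LinearMap.det_toMatrix]; exact isUnit_iff_ne_zero.2 hudet)
  have hT (x : V) : T x = p (u x) := rfl
  -- Taking `w = u x` and `w = -u x` turns the one-sided condition into an equality.
  have hcrit {g : V →ₗ[ℝ] ℝ} (hg : ∀ c ∈ C, u c ∈ frontier (D : Set W) → g c = 0) (x : V) :
      g x = finrank ℝ V * (g c₀ * φ (u x)) := by
    have h1 := first_order_of_isMax_det hC hf hw₀ _ hu hu1 hmax T hT hg (u x)
    have h2 := first_order_of_isMax_det hC hf hw₀ _ hu hu1 hmax T hT hg (-u x)
    simp only [map_neg, LinearMap.coe_toContinuousLinearMap', ← hT, T.symm_apply_apply] at h1 h2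
    linarith
  refine ⟨u, fun x y hxy => T.injective (by rw [hT, hT]; exact congrArg p hxy), hu, ?_⟩
  by_contra hne
  obtain ⟨g, hg0, hgker⟩ := Submodule.exists_le_ker_of_lt_top _ (lt_top_iff_ne_top.2 hne)
  have hg : ∀ c ∈ C, u c ∈ frontier (D : Set W) → g c = 0 := fun c hc hcf =>
    hgker (Submodule.subset_span ⟨hc, hcf⟩)
  have hzero : ∀ c ∈ C, u c ∈ frontier (D : Set W) → c = 0 := by
    intro c hc hcf
    by_contra hc0
    have huc : u c ≠ 0 := fun h => hc0 (T.injective (by rw [hT, h]; simp))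
    have h1 := hcrit hg c
    rw [hg c hc hcf] at h1
    have hgc₀ : g c₀ = 0 := by
      have h2 : (finrank ℝ V : ℝ) ≠ 0 := by positivity
      have h3 := (hφ _ (hu c hc) huc).ne'
      simpa [h2, h3] using h1.symm
    exact hg0 (LinearMap.ext fun x => by rw [hcrit hg x, hgc₀]; simp)
  -- With no nonzero vector sent to the frontier, every functional satisfies `hcrit`, so all of them
  -- vanish on the kernel of `φ ∘ u`.
  have hinj : Function.Injective (φ ∘ₗ (u : V →ₗ[ℝ] W)) := by
    rw [← LinearMap.ker_eq_bot, LinearMap.ker_eq_bot']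
    intro x hx
    have hx : φ (u x) = 0 := hx
    refine (Module.forall_dual_apply_eq_zero_iff ℝ x).1 fun g' => ?_
    rw [hcrit (g := g') (fun c hc hcf => by rw [hzero c hc hcf, map_zero]) x, hx]
    simp
  have := LinearMap.finrank_le_finrank_of_injective hinj
  rw [finrank_self] at this
  omega

end PointedCone
end Core

theorem exists_topologicalSpace_of_finiteDimensional (V : Type*) [AddCommGroup V] [Module ℝ V]
    [FiniteDimensional ℝ V] : ∃ _ : TopologicalSpace V,
      IsTopologicalAddGroup V ∧ ContinuousSMul ℝ V ∧ T2Space V := by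
  let e := (finBasis ℝ V).equivFun
  let τ : TopologicalSpace V := TopologicalSpace.induced e inferInstance
  exact ⟨τ, topologicalAddGroup_induced e, continuousSMul_induced e.toLinearMap,
    T2Space.of_injective_continuous e.injective continuous_induced_dom⟩

namespace PointedCone

/-! ### Duality for closed cones, and transfer from normed coordinates. -/

section TVS

variable {E : Type*} [AddCommGroup E] [Module ℝ E] [FiniteDimensional ℝ E]
  [TopologicalSpace E] [IsTopologicalAddGroup E] [ContinuousSMul ℝ E] [T2Space E]

theorem _root_.LocallyConvexSpace.of_finiteDimensional : LocallyConvexSpace ℝ E := by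
  let e : E ≃L[ℝ] (Fin (finrank ℝ E) → ℝ) := ContinuousLinearEquiv.ofFinrankEq (by simp)
  have h := e.toHomeomorph.isInducing.eq_induced
  have h2 := LocallyConvexSpace.induced (𝕜 := ℝ) (e : E →ₗ[ℝ] (Fin (finrank ℝ E) → ℝ))
  exact h ▸ h2

theorem exists_mem_dual_apply_neg {C : PointedCone ℝ E} (hC : IsClosed (C : Set E)) {x : E}
    (hx : x ∉ C) : ∃ φ ∈ dual (Dual.eval ℝ E) (C : Set E), φ x < 0 := by
  have : LocallyConvexSpace ℝ E := .of_finiteDimensional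
  obtain ⟨f, hf, hfx⟩ := ProperCone.hyperplane_separation_point (⟨C, hC⟩ : ProperCone ℝ E) hx
  exact ⟨f, hf, hfx⟩

theorem mem_of_forall_mem_dual {C : PointedCone ℝ E} (hC : IsClosed (C : Set E)) {x : E}
    (hx : ∀ φ ∈ dual (Dual.eval ℝ E) (C : Set E), 0 ≤ φ x) : x ∈ C := by
  by_contra h
  obtain ⟨φ, hφ, hφx⟩ := exists_mem_dual_apply_neg hC h
  exact (hx φ hφ).not_gt hφx

theorem span_dual_eq_top {C : PointedCone ℝ E} (hC : IsClosed (C : Set E))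
    (hp : C.lineal = ⊥) : Submodule.span ℝ (dual (Dual.eval ℝ E) (C : Set E) : Set (Dual ℝ E)) =
      ⊤ := by
  by_contra hne
  obtain ⟨g, hg0, hg⟩ := Submodule.exists_le_ker_of_lt_top _ (lt_top_iff_ne_top.2 hne)
  obtain ⟨x, rfl⟩ := (evalEquiv ℝ E).surjective g
  have hx : ∀ φ ∈ dual (Dual.eval ℝ E) (C : Set E), φ x = 0 := fun φ hφ =>
    hg (Submodule.subset_span hφ)
  have hmem : x ∈ C.lineal := ⟨mem_of_forall_mem_dual hC fun φ hφ => (hx φ hφ).ge,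
    mem_of_forall_mem_dual hC fun φ hφ => by simp [hx φ hφ]⟩
  rw [hp, Submodule.mem_bot] at hmem
  exact hg0 (by simp [hmem])

theorem _root_.Module.exists_basis_of_span_eq_top {V : Type*} [AddCommGroup V] [Module ℝ V]
    [FiniteDimensional ℝ V] {s : Set V} (hs : Submodule.span ℝ s = ⊤) :
    ∃ b : Basis (Fin (finrank ℝ V)) ℝ V, ∀ i, b i ∈ s := by
  have h := Submodule.exists_fun_fin_finrank_span_eq ℝ s
  rw [hs, finrank_top] at h
  obtain ⟨b, hbs, hb, hli⟩ := h
  exact ⟨Basis.mk hli hb.ge, fun i => by simpa using hbs i⟩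

/-- The dual cone spans, so it contains a basis of the dual space; the sum of that basis can vanish
at a point of `C` only if every functional does. -/
theorem exists_strictly_positive {C : PointedCone ℝ E} (hC : IsClosed (C : Set E))
    (hp : C.lineal = ⊥) : ∃ f : E →ₗ[ℝ] ℝ, ∀ x ∈ C, x ≠ 0 → 0 < f x := by
  obtain ⟨b, hb⟩ := exists_basis_of_span_eq_top (span_dual_eq_top hC hp)
  refine ⟨∑ i, b i, fun x hx hx0 => ?_⟩
  rw [LinearMap.sum_apply]
  refine (Finset.sum_nonneg fun i _ => hb i hx).lt_of_ne' fun h0 => hx0 ?_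
  rw [Finset.sum_eq_zero_iff_of_nonneg fun i _ => hb i hx] at h0
  refine (Module.forall_dual_apply_eq_zero_iff ℝ x).1 fun φ => ?_
  rw [← b.sum_repr φ, LinearMap.sum_apply]
  refine Finset.sum_eq_zero fun i hi => ?_
  rw [LinearMap.smul_apply, show b i x = 0 from h0 i hi, smul_zero]

theorem lineal_dual_eq_bot {V : Type*} [AddCommGroup V] [Module ℝ V] {C : PointedCone ℝ V}
    (hC : Submodule.span ℝ (C : Set V) = ⊤) :
    (dual (Dual.eval ℝ V) (C : Set V)).lineal = ⊥ := by
  refine (Submodule.eq_bot_iff _).2 fun φ ⟨h1, h2⟩ => ?_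
  refine LinearMap.ext_on hC fun x hx => ?_
  have h1 : 0 ≤ φ x := h1 hx
  have h2 : 0 ≤ -φ x := h2 hx
  exact le_antisymm (neg_nonneg.1 h2) h1

theorem isClosed_dual_of_finiteDimensional {V : Type*} [AddCommGroup V] [Module ℝ V]
    [FiniteDimensional ℝ V] [TopologicalSpace (Dual ℝ V)] [IsTopologicalAddGroup (Dual ℝ V)]
    [ContinuousSMul ℝ (Dual ℝ V)] [T2Space (Dual ℝ V)] (s : Set V) :
    IsClosed (dual (Dual.eval ℝ V) s : Set (Dual ℝ V)) :=
  isClosed_dual fun _ => LinearMap.continuous_of_finiteDimensional _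

theorem span_comap_equiv {V V' : Type*} [AddCommGroup V] [Module ℝ V] [AddCommGroup V']
    [Module ℝ V'] (e : V' ≃ₗ[ℝ] V) {s : Set V} (hs : Submodule.span ℝ s = ⊤) :
    Submodule.span ℝ (e ⁻¹' s) = ⊤ := by
  have : e ⁻¹' s = e.symm '' s := (LinearEquiv.image_symm_eq_preimage e s).symm
  rw [this, ← LinearEquiv.coe_toLinearMap e.symm, Submodule.span_image, hs, Submodule.map_top,
    LinearEquiv.range]

theorem interior_nonempty_of_normed {V : Type*} [NormedAddCommGroup V] [NormedSpace ℝ V]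
    [FiniteDimensional ℝ V] {C : PointedCone ℝ V} (hC : Submodule.span ℝ (C : Set V) = ⊤) :
    (interior (C : Set V)).Nonempty := by
  have hconv : Convex ℝ (C : Set V) := C.toConvexCone.convex
  rw [hconv.interior_nonempty_iff_affineSpan_eq_top,
    AffineSubspace.affineSpan_eq_top_iff_vectorSpan_eq_top_of_nonempty ℝ V V ⟨0, C.zero_mem⟩,
    vectorSpan_eq_span_vsub_set_right ℝ (show (0 : V) ∈ (C : Set V) from C.zero_mem)]
  simpa using hC

theorem interior_nonempty {C : PointedCone ℝ E} (hC : Submodule.span ℝ (C : Set E) = ⊤) :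
    (interior (C : Set E)).Nonempty := by
  let e : (Fin (finrank ℝ E) → ℝ) ≃L[ℝ] E := ContinuousLinearEquiv.ofFinrankEq (by simp)
  obtain ⟨y, hy⟩ := interior_nonempty_of_normed
    (C := C.comap (e : (Fin (finrank ℝ E) → ℝ) →ₗ[ℝ] E)) (span_comap_equiv e.toLinearEquiv hC)
  have h := e.toHomeomorph.preimage_interior (C : Set E)
  exact ⟨e y, h.symm.subset hy⟩

theorem exists_positive_injective_span_frontier_eq_top {F : Type*} [AddCommGroup F] [Module ℝ F]
    [FiniteDimensional ℝ F] [TopologicalSpace F] [IsTopologicalAddGroup F] [ContinuousSMul ℝ F]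
    [T2Space F] {C : PointedCone ℝ E} {D : PointedCone ℝ F}
    (hC : IsClosed (C : Set E)) (hD : IsClosed (D : Set F))
    (hCp : C.lineal = ⊥) (hDp : D.lineal = ⊥)
    (hCs : Submodule.span ℝ (C : Set E) = ⊤) (hDs : Submodule.span ℝ (D : Set F) = ⊤)
    (hdim : finrank ℝ E ≤ finrank ℝ F) (hE : 1 < finrank ℝ E) :
    ∃ u : E →ₗ[ℝ] F, Function.Injective u ∧ (∀ c ∈ C, u c ∈ D) ∧
      Submodule.span ℝ {c | c ∈ C ∧ u c ∈ frontier (D : Set F)} = ⊤ := by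
  let e : (Fin (finrank ℝ E) → ℝ) ≃L[ℝ] E := ContinuousLinearEquiv.ofFinrankEq (by simp)
  let e' : (Fin (finrank ℝ F) → ℝ) ≃L[ℝ] F := ContinuousLinearEquiv.ofFinrankEq (by simp)
  obtain ⟨f, hf⟩ := exists_strictly_positive hC hCp
  obtain ⟨φ, hφ⟩ := exists_strictly_positive hD hDp
  obtain ⟨u, hu, huC, hspan⟩ := exists_positive_injective_span_eq_top
    (C := C.comap (e : (Fin (finrank ℝ E) → ℝ) →ₗ[ℝ] E))
    (D := D.comap (e' : (Fin (finrank ℝ F) → ℝ) →ₗ[ℝ] F))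
    (hC.preimage e.continuous) (hD.preimage e'.continuous)
    (f := f ∘ₗ (e : (Fin (finrank ℝ E) → ℝ) →ₗ[ℝ] E))
    (fun x hx hx0 => hf _ hx fun h => hx0 (e.injective (h.trans (map_zero e).symm)))
    (interior_nonempty_of_normed (span_comap_equiv e.toLinearEquiv hCs))
    (φ := φ ∘ₗ (e' : (Fin (finrank ℝ F) → ℝ) →ₗ[ℝ] F))
    (fun x hx hx0 => hφ _ hx fun h => hx0 (e'.injective (h.trans (map_zero e').symm)))
    (interior_nonempty_of_normed (span_comap_equiv e'.toLinearEquiv hDs))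
    (by simpa using hdim) (by simpa using hE)
  refine ⟨e'.toLinearEquiv.toLinearMap ∘ₗ u ∘ₗ e.symm.toLinearEquiv.toLinearMap,
    e'.injective.comp (hu.comp e.symm.injective), fun c hc => ?_, ?_⟩
  · exact huC (e.symm c) (show e (e.symm c) ∈ C by rwa [e.apply_symm_apply])
  · convert span_comap_equiv e.symm.toLinearEquiv hspan using 2
    ext c
    have h := e'.toHomeomorph.preimage_frontier (D : Set F)
    have h1 : e.symm c ∈ C.comap (e : (Fin (finrank ℝ E) → ℝ) →ₗ[ℝ] E) ↔ c ∈ C := by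
      change e (e.symm c) ∈ C ↔ c ∈ C
      rw [e.apply_symm_apply]
    have h2 : u (e.symm c) ∈ frontier
        (D.comap (e' : (Fin (finrank ℝ F) → ℝ) →ₗ[ℝ] F) : Set (Fin (finrank ℝ F) → ℝ)) ↔
        e' (u (e.symm c)) ∈ frontier (D : Set F) := (Set.ext_iff.1 h _).symm
    exact (and_congr h1 h2).symm

theorem eq_zero_of_mem_interior {C : PointedCone ℝ E} {φ : Dual ℝ E}
    (hφ : φ ∈ dual (Dual.eval ℝ E) (C : Set E)) {x : E} (hx : x ∈ interior (C : Set E))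
    (hφx : φ x = 0) : φ = 0 := by
  have key (y : E) : 0 ≤ φ y := by
    have hline : Tendsto (fun s : ℝ => x + s • y) (𝓝 0) (𝓝 x) := by
      have : Continuous fun s : ℝ => x + s • y := by fun_prop
      simpa using this.tendsto 0
    have hev : ∀ᶠ s : ℝ in 𝓝 0, x + s • y ∈ C :=
      hline.eventually (mem_interior_iff_mem_nhds.1 hx)
    obtain ⟨s, h1, hs⟩ := ((hev.filter_mono nhdsWithin_le_nhds).and
      (self_mem_nhdsWithin : Set.Ioi (0 : ℝ) ∈ 𝓝[>] 0)).exists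
    have h2 : 0 ≤ φ (x + s • y) := hφ h1
    rw [map_add, map_smul, hφx, zero_add, smul_eq_mul] at h2
    exact nonneg_of_mul_nonneg_right h2 hs
  ext y
  have h := key (-y)
  rw [map_neg] at h
  exact le_antisymm (neg_nonneg.1 h) (key y)

/-- Hahn–Banach separates `φ` from the interior of the dual cone by an evaluation at some `x`.
Comparing with `0` and `2 • φ` gives `φ x = 0`, and then `x` is in `C` by biduality. -/
theorem exists_apply_eq_zero_of_mem_frontier_dual {C : PointedCone ℝ E} (hC : IsClosed (C : Set E))
    (hp : C.lineal = ⊥) [TopologicalSpace (Dual ℝ E)] [IsTopologicalAddGroup (Dual ℝ E)]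
    [ContinuousSMul ℝ (Dual ℝ E)] [T2Space (Dual ℝ E)] {φ : Dual ℝ E}
    (hφ : φ ∈ frontier (dual (Dual.eval ℝ E) (C : Set E) : Set (Dual ℝ E))) :
    ∃ x ∈ C, x ≠ 0 ∧ φ x = 0 := by
  set K := dual (Dual.eval ℝ E) (C : Set E)
  have hK : IsClosed (K : Set (Dual ℝ E)) := isClosed_dual_of_finiteDimensional _
  have hφK : φ ∈ K := hK.closure_eq.subset hφ.1
  have hconv : Convex ℝ (K : Set (Dual ℝ E)) := K.toConvexCone.convex
  obtain ⟨ψ, hψ⟩ := interior_nonempty (span_dual_eq_top hC hp)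
  obtain ⟨f, hf⟩ := geometric_hahn_banach_point_open (E := Dual ℝ E)
    hconv.interior isOpen_interior hφ.2
  obtain ⟨x, hx⟩ := (evalEquiv ℝ E).surjective f.toLinearMap
  have hfx (χ : Dual ℝ E) : f χ = χ x := (LinearMap.congr_fun hx χ).symm
  have hle : ∀ χ ∈ K, φ x ≤ χ x := by
    intro χ hχ
    have hχ' : χ ∈ closure (interior (K : Set (Dual ℝ E))) := by
      rw [hconv.closure_interior_eq_closure_of_nonempty_interior ⟨ψ, hψ⟩]
      exact subset_closure hχ
    have hcl : IsClosed {χ : Dual ℝ E | f φ ≤ f χ} := isClosed_le continuous_const f.continuous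
    have : f φ ≤ f χ := closure_minimal (fun χ hχ => (hf χ hχ).le) hcl hχ'
    rwa [hfx, hfx] at this
  have h0 : φ x = 0 := by
    have h1 := hle 0 K.zero_mem
    have h2 := hle ((2 : ℝ) • φ) (K.smul_mem (by norm_num) hφK)
    simp only [LinearMap.smul_apply, LinearMap.zero_apply, smul_eq_mul] at h1 h2
    linarith
  refine ⟨x, mem_of_forall_mem_dual hC fun χ hχ => h0 ▸ hle χ hχ, ?_, h0⟩
  rintro rfl
  simpa [hfx] using hf ψ hψ

/-- The dual of a smooth cone is strictly convex. -/
theorem IsSmoothCone.isStrictlyConvexCone_dual {C : PointedCone ℝ E} (h : C.IsSmoothCone)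
    (hC : IsClosed (C : Set E)) (hp : C.lineal = ⊥) (hs : Submodule.span ℝ (C : Set E) = ⊤)
    [TopologicalSpace (Dual ℝ E)] [IsTopologicalAddGroup (Dual ℝ E)]
    [ContinuousSMul ℝ (Dual ℝ E)] [T2Space (Dual ℝ E)] :
    (dual (Dual.eval ℝ E) (C : Set E)).IsStrictlyConvexCone := by
  intro φ hφ hφ0
  obtain ⟨x, hxC, hx0, hφx⟩ := exists_apply_eq_zero_of_mem_frontier_dual hC hp hφ
  have hφK : φ ∈ dual (Dual.eval ℝ E) (C : Set E) :=
    (isClosed_dual_of_finiteDimensional _).closure_eq.subset hφ.1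
  have hxf : x ∈ frontier (C : Set E) :=
    ⟨subset_closure hxC, fun hint => hφ0 (eq_zero_of_mem_interior hφK hint hφx)⟩
  refine ⟨hφK, hφ0, fun χ hχ χ' hχ' hsum => ?_⟩
  have hχx : χ x = 0 := by
    have h1 : 0 ≤ χ x := hχ hxC
    have h2 : 0 ≤ χ' x := hχ' hxC
    have h3 : χ x + χ' x = 0 := by rw [← hφx, ← hsum, LinearMap.add_apply]
    linarith
  rcases eq_or_ne χ 0 with rfl | hχ0
  · exact ⟨0, le_rfl, by simp⟩
  -- The summand `χ` also supports `C` at `x`; uniqueness of the hyperplane gives equal kernels,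
  -- hence proportionality.
  have hH : {y | φ y = φ x} = {y | χ y = χ x} :=
    (h x hxf hx0).unique ⟨φ, hφ0, fun y hy => hφx ▸ hφK hy, rfl⟩
      ⟨χ, hχ0, fun y hy => hχx ▸ hχ hy, rfl⟩
  rw [hφx, hχx] at hH
  obtain ⟨y, hyC, hy⟩ : ∃ y ∈ C, φ y ≠ 0 := by
    by_contra! hall
    exact hφ0 (LinearMap.ext_on hs hall)
  have hpos : 0 < φ y := (hφK hyC : 0 ≤ φ y).lt_of_ne' hy
  refine ⟨χ y / φ y, div_nonneg (hχ hyC) hpos.le, ?_⟩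
  ext z
  have hz : z - (φ z / φ y) • y ∈ {y | φ y = 0} := by
    simp [hy]
  rw [hH] at hz
  have hz : χ (z - (φ z / φ y) • y) = 0 := hz
  simp only [map_sub, map_smul, smul_eq_mul, LinearMap.smul_apply] at hz ⊢
  field_simp at hz ⊢
  linarith

end TVS
end PointedCone

namespace PointedCone

/-! ### Closedness of the projective cone and passage to duals. -/

section Topological

variable {E : Type*} [AddCommGroup E] [Module ℝ E] [FiniteDimensional ℝ E]
  [TopologicalSpace E] [IsTopologicalAddGroup E] [ContinuousSMul ℝ E] [T2Space E]

/-- By Carathéodory, at most `finrank + 1` points are needed, so the hull is a finite union of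
continuous images of compact sets. -/
theorem _root_.IsCompact.convexHull_of_finiteDimensional {s : Set E} (hs : IsCompact s) :
    IsCompact (convexHull ℝ s) := by
  let Φ (k : ℕ) (q : (Fin k → ℝ) × (Fin k → E)) : E := ∑ i, q.1 i • q.2 i
  have hΦ (k : ℕ) : Continuous (Φ k) := by fun_prop
  have key : convexHull ℝ s = ⋃ k ∈ Finset.range (finrank ℝ E + 2),
      Φ k '' (stdSimplex ℝ (Fin k) ×ˢ Set.univ.pi fun _ => s) := by
    refine Set.Subset.antisymm (fun x hx => ?_) (Set.iUnion₂_subset fun k _ => ?_)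
    · obtain ⟨ι, _, z, w, hz, hind, hw, hw1, rfl⟩ := eq_pos_convex_span_of_mem_convexHull hx
      have hcard : Fintype.card ι < finrank ℝ E + 2 := by
        have h1 := hind.card_le_finrank_succ
        have h2 := Submodule.finrank_le (vectorSpan ℝ (Set.range z))
        omega
      let e := (Fintype.equivFin ι).symm
      refine Set.mem_biUnion (Finset.mem_coe.2 (Finset.mem_range.2 hcard))
        ⟨(w ∘ e, z ∘ e), ⟨⟨fun i => (hw _).le, ?_⟩, fun i _ => hz ⟨_, rfl⟩⟩, ?_⟩
      · exact (e.sum_comp w).trans hw1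
      · exact e.sum_comp fun i => w i • z i
    · rintro _ ⟨⟨w, z⟩, ⟨⟨hw, hw1⟩, hz⟩, rfl⟩
      exact (convex_convexHull ℝ s).sum_mem (fun i _ => hw i) hw1
        fun i _ => subset_convexHull ℝ s (hz i trivial)
  rw [key]
  exact (Finset.range (finrank ℝ E + 2)).isCompact_biUnion fun k _ =>
    ((isCompact_stdSimplex ℝ (Fin k)).prod (isCompact_univ_pi fun _ => hs)).image (hΦ k)

/-- The cone is the projection, along the compact factor `convexHull ℝ s`, of the closed set of
pairs `(x, k)` with `x = f x • k` and `0 ≤ f x`. -/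
theorem isClosed_hull_of_isCompact {s : Set E} (hs : IsCompact s) (f : E →ₗ[ℝ] ℝ)
    (hf : ∀ x ∈ s, f x = 1) : IsClosed (hull ℝ s : Set E) := by
  rcases s.eq_empty_or_nonempty with rfl | ⟨x₀, hx₀⟩
  · simp
  have hfc : Continuous f := f.continuous_of_finiteDimensional
  have hconv := convex_convexHull ℝ s
  have key : (hull ℝ s : Set E) = Prod.fst '' {q : E × convexHull ℝ s |
      0 ≤ f q.1 ∧ q.1 = f q.1 • (q.2 : E)} := by
    ext x
    constructor
    · intro hx
      induction hx using Submodule.span_induction with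
      | mem x h =>
        exact ⟨(x, ⟨x, subset_convexHull ℝ s h⟩), by simp [hf x h], rfl⟩
      | zero => exact ⟨(0, ⟨x₀, subset_convexHull ℝ s hx₀⟩), by simp, rfl⟩
      | add x y _ _ hx hy =>
        obtain ⟨⟨x, k⟩, ⟨h1, h2⟩, rfl⟩ := hx
        obtain ⟨⟨y, l⟩, ⟨h3, h4⟩, rfl⟩ := hy
        dsimp only at h1 h2 h3 h4 ⊢
        rcases eq_or_lt_of_le (add_nonneg h1 h3) with h | h
        · have h5 : f x = 0 := by linarith
          have h6 : f y = 0 := by linarith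
          rw [h5, zero_smul] at h2
          rw [h6, zero_smul] at h4
          exact ⟨(0, k), by simp, by simp [h2, h4]⟩
        · refine ⟨(x + y, ⟨(f x / (f x + f y)) • (k : E) + (f y / (f x + f y)) • (l : E),
            hconv k.2 l.2 (by positivity) (by positivity) (by field_simp)⟩), ⟨?_, ?_⟩, rfl⟩
          · simpa using h.le
          · simp only [map_add, smul_add, smul_smul]
            rw [mul_div_cancel₀ _ h.ne', mul_div_cancel₀ _ h.ne', ← h2, ← h4]
      | smul a x _ hx =>
        obtain ⟨⟨x, k⟩, ⟨h1, h2⟩, rfl⟩ := hx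
        dsimp only at h1 h2 ⊢
        refine ⟨((a : ℝ) • x, k), ⟨?_, ?_⟩, rfl⟩
        · change 0 ≤ f ((a : ℝ) • x)
          rw [map_smul]
          exact mul_nonneg a.2 h1
        · simp only [map_smul, smul_eq_mul, mul_smul, ← h2]
    · rintro ⟨⟨x, k⟩, ⟨h1, h2⟩, rfl⟩
      dsimp only at h1 h2 ⊢
      rw [h2]
      have hsub : convexHull ℝ s ⊆ (hull ℝ s : Set E) :=
        convexHull_min Submodule.subset_span (hull ℝ s).toConvexCone.convex
      exact (hull ℝ s).smul_mem h1 (hsub k.2)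
  rw [key]
  have := isCompact_iff_compactSpace.1 hs.convexHull_of_finiteDimensional
  refine isClosedMap_fst_of_compactSpace _ ?_
  refine (isClosed_le continuous_const (hfc.comp continuous_fst)).inter
    (isClosed_eq continuous_fst ?_)
  fun_prop

theorem isCompact_slice_of_finiteDimensional {C : PointedCone ℝ E} (hC : IsClosed (C : Set E))
    (f : E →ₗ[ℝ] ℝ) (hf : ∀ x ∈ C, x ≠ 0 → 0 < f x) : IsCompact {x | x ∈ C ∧ f x = 1} := by
  let e : (Fin (finrank ℝ E) → ℝ) ≃L[ℝ] E := ContinuousLinearEquiv.ofFinrankEq (by simp)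
  have h := isCompact_slice (C := C.comap (e : (Fin (finrank ℝ E) → ℝ) →ₗ[ℝ] E))
    (hC.preimage e.continuous) (f ∘ₗ (e : (Fin (finrank ℝ E) → ℝ) →ₗ[ℝ] E))
    (fun x hx hx0 => hf _ hx fun h => hx0 (e.injective (h.trans (map_zero e).symm)))
  convert h.image e.continuous using 1
  ext x
  exact ⟨fun hx => ⟨e.symm x, by simpa [mem_comap] using hx, by simp⟩,
    by rintro ⟨y, hy, rfl⟩; exact hy⟩

theorem isClosed_minTensorProduct {F : Type*} [AddCommGroup F] [Module ℝ F] [FiniteDimensional ℝ F]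
    [TopologicalSpace F] [IsTopologicalAddGroup F] [ContinuousSMul ℝ F] [T2Space F]
    [TopologicalSpace (E ⊗[ℝ] F)] [IsTopologicalAddGroup (E ⊗[ℝ] F)]
    [ContinuousSMul ℝ (E ⊗[ℝ] F)] [T2Space (E ⊗[ℝ] F)]
    {C : PointedCone ℝ E} {D : PointedCone ℝ F} (hC : IsClosed (C : Set E))
    (hD : IsClosed (D : Set F)) (hCp : C.lineal = ⊥) (hDp : D.lineal = ⊥) :
    IsClosed (minTensorProduct C D : Set (E ⊗[ℝ] F)) := by
  obtain ⟨f, hf⟩ := exists_strictly_positive hC hCp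
  obtain ⟨g, hg⟩ := exists_strictly_positive hD hDp
  set s := Set.image2 (fun (x : E) (y : F) => x ⊗ₜ[ℝ] y) {x | x ∈ C ∧ f x = 1}
    {y | y ∈ D ∧ g y = 1} with hs
  have : IsModuleTopology ℝ E := isModuleTopologyOfFiniteDimensional
  have : IsModuleTopology ℝ F := isModuleTopologyOfFiniteDimensional
  have : IsModuleTopology ℝ (E ⊗[ℝ] F) := isModuleTopologyOfFiniteDimensional
  have hcont : Continuous fun q : E × F => q.1 ⊗ₜ[ℝ] q.2 :=
    IsModuleTopology.continuous_bilinear_of_finite_left (TensorProduct.mk ℝ E F)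
  have hcomp : IsCompact s := by
    rw [hs, ← Set.image_prod]
    exact ((isCompact_slice_of_finiteDimensional hC f hf).prod
      (isCompact_slice_of_finiteDimensional hD g hg)).image hcont
  have heq : minTensorProduct C D = hull ℝ s := by
    refine le_antisymm (Submodule.span_le.2 ?_) (Submodule.span_mono ?_)
    · rintro _ ⟨x, hx, y, hy, rfl⟩
      rcases eq_or_ne x 0 with rfl | hx0
      · simp
      rcases eq_or_ne y 0 with rfl | hy0
      · simp
      have h1 := hf x hx hx0
      have h2 := hg y hy hy0
      have h3 : ((f x)⁻¹ • x) ⊗ₜ[ℝ] ((g y)⁻¹ • y) ∈ hull ℝ s := Submodule.subset_span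
        ⟨_, ⟨C.smul_mem (by positivity) hx, by simp [h1.ne']⟩, _,
          ⟨D.smul_mem (by positivity) hy, by simp [h2.ne']⟩, rfl⟩
      have h4 := (hull ℝ s).smul_mem (mul_pos h1 h2).le h3
      rw [TensorProduct.smul_tmul_smul, smul_smul,
        show f x * g y * ((f x)⁻¹ * (g y)⁻¹) = 1 by field_simp, one_smul] at h4
      exact h4
    · rintro _ ⟨x, hx, y, hy, rfl⟩
      exact ⟨x, hx.1, y, hy.1, rfl⟩
  rw [heq]
  refine isClosed_hull_of_isCompact hcomp (dualDistrib ℝ E F (f ⊗ₜ g)) ?_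
  rintro _ ⟨x, hx, y, hy, rfl⟩
  simp [hx.2, hy.2]

/-- Equality of the two tensor products passes to the dual cones. -/
theorem minTensorProduct_dual_eq_maxTensorProduct_dual {F : Type*} [AddCommGroup F] [Module ℝ F]
    [FiniteDimensional ℝ F] [TopologicalSpace F] [IsTopologicalAddGroup F] [ContinuousSMul ℝ F]
    [T2Space F] {C : PointedCone ℝ E} {D : PointedCone ℝ F}
    (hC : Submodule.span ℝ (C : Set E) = ⊤) (hD : Submodule.span ℝ (D : Set F) = ⊤)
    (h : minTensorProduct C D = maxTensorProduct C D) :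
    minTensorProduct (dual (Dual.eval ℝ E) (C : Set E)) (dual (Dual.eval ℝ F) (D : Set F)) =
      maxTensorProduct (dual (Dual.eval ℝ E) (C : Set E)) (dual (Dual.eval ℝ F) (D : Set F)) := by
  refine le_antisymm (minTensorProduct_le_maxTensorProduct _ _) fun t ht => ?_
  by_contra hmin
  obtain ⟨_, _, _, _⟩ := exists_topologicalSpace_of_finiteDimensional (Dual ℝ E)
  obtain ⟨_, _, _, _⟩ := exists_topologicalSpace_of_finiteDimensional (Dual ℝ F)
  obtain ⟨_, _, _, _⟩ := exists_topologicalSpace_of_finiteDimensional (Dual ℝ E ⊗[ℝ] Dual ℝ F)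
  obtain ⟨L, hL, hLt⟩ := exists_mem_dual_apply_neg (isClosed_minTensorProduct
    (isClosed_dual_of_finiteDimensional _) (isClosed_dual_of_finiteDimensional _)
    (lineal_dual_eq_bot hC) (lineal_dual_eq_bot hD)) hmin
  -- The separating functional is pairing with a tensor `z`, which lies in the injective cone of `C`
  -- and `D`, hence in the projective one, and so pairs non-negatively with `t`.
  obtain ⟨z, hz⟩ := (evalEquiv ℝ (E ⊗[ℝ] F)).surjective
    (L ∘ₗ (dualDistribEquiv ℝ E F).symm.toLinearMap)
  have hLz (a : Dual ℝ E ⊗[ℝ] Dual ℝ F) : L a = dualDistrib ℝ E F a z := by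
    have h1 := LinearMap.congr_fun hz (dualDistribEquiv ℝ E F a)
    simp only [LinearMap.comp_apply, LinearEquiv.coe_coe, LinearEquiv.symm_apply_apply] at h1
    exact h1.symm
  have hzmin : z ∈ minTensorProduct C D := by
    rw [h, mem_maxTensorProduct]
    intro φ hφ ψ hψ
    rw [← hLz]
    exact hL (tmul_mem_minTensorProduct hφ hψ)
  rw [hLz] at hLt
  refine hLt.not_ge ?_
  clear hLt hLz hz
  induction hzmin using Submodule.span_induction with
  | mem z hz =>
    obtain ⟨x, hx, y, hy, rfl⟩ := hz
    have h1 := mem_maxTensorProduct.1 ht (Dual.eval ℝ E x) (fun φ hφ => hφ hx)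
      (Dual.eval ℝ F y) (fun ψ hψ => hψ hy)
    have h2 : dualDistrib ℝ (Dual ℝ E) (Dual ℝ F) (Dual.eval ℝ E x ⊗ₜ Dual.eval ℝ F y) =
        (dualDistrib ℝ E F).flip (x ⊗ₜ y) := TensorProduct.ext' fun a b => by simp
    rwa [h2] at h1
  | zero => simp
  | add x y _ _ hx hy => rw [map_add]; exact add_nonneg hx hy
  | smul a x _ hx =>
    have : a • x = (a : ℝ) • x := rfl
    rw [this, map_smul]
    exact mul_nonneg a.2 hx

end Topological

/-! ### Simplex cones and predual bases. -/

section Simplex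

variable {F : Type*} [AddCommGroup F] [Module ℝ F] [FiniteDimensional ℝ F]

theorem _root_.Module.Basis.exists_predual_basis {n : ℕ} (b : Basis (Fin n) ℝ (Dual ℝ F)) :
    ∃ e : Basis (Fin n) ℝ F, ∀ i j, b i (e j) = if i = j then 1 else 0 := by
  refine ⟨b.dualBasis.map (evalEquiv ℝ F).symm, fun i j => ?_⟩
  have h : evalEquiv ℝ F ((b.dualBasis.map (evalEquiv ℝ F).symm) j) = b.dualBasis j := by simp
  have h2 := LinearMap.congr_fun h (b i)
  rw [b.dualBasis_apply_self] at h2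
  exact h2

theorem _root_.Module.Basis.sum_predual {n : ℕ} {b : Basis (Fin n) ℝ (Dual ℝ F)}
    {e : Basis (Fin n) ℝ F} (h : ∀ i j, b i (e j) = if i = j then 1 else 0) (y : F) :
    ∑ i, b i y • e i = y := by
  have hb (i : Fin n) : b i = e.coord i :=
    e.ext fun j => by simp [h, Finsupp.single_apply, eq_comm]
  simp [hb]

theorem _root_.Module.Basis.sum_dual {n : ℕ} {b : Basis (Fin n) ℝ (Dual ℝ F)}
    {e : Basis (Fin n) ℝ F} (h : ∀ i j, b i (e j) = if i = j then 1 else 0) (ψ : Dual ℝ F) :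
    ∑ i, ψ (e i) • b i = ψ :=
  e.ext fun j => by simp [h]

theorem IsSimplexCone.of_dual [TopologicalSpace F] [IsTopologicalAddGroup F] [ContinuousSMul ℝ F]
    [T2Space F] {D : PointedCone ℝ F} (hD : IsClosed (D : Set F))
    (h : (dual (Dual.eval ℝ F) (D : Set F)).IsSimplexCone) : D.IsSimplexCone := by
  obtain ⟨n, b, hb⟩ := h
  obtain ⟨e, he⟩ := b.exists_predual_basis
  refine ⟨n, e, le_antisymm (fun y hy => ?_) (Submodule.span_le.2 ?_)⟩
  · rw [← Basis.sum_predual he y]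
    have hbi (i : Fin n) : b i ∈ dual (Dual.eval ℝ F) (D : Set F) :=
      hb ▸ Submodule.subset_span ⟨i, rfl⟩
    exact Submodule.sum_mem _ fun i _ =>
      (hull ℝ (Set.range e)).smul_mem (hbi i hy) (Submodule.subset_span ⟨i, rfl⟩)
  · rintro _ ⟨j, rfl⟩
    refine mem_of_forall_mem_dual hD fun φ hφ => ?_
    rw [hb] at hφ
    induction hφ using Submodule.span_induction with
    | mem φ hφ =>
      obtain ⟨i, rfl⟩ := hφ
      rw [he]
      split_ifs <;> norm_num
    | zero => simp
    | add φ ψ _ _ h1 h2 => exact add_nonneg h1 h2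
    | smul a φ _ h1 => exact mul_nonneg a.2 h1

theorem isSimplexCone_of_finrank_le_one {D : PointedCone ℝ F} (hp : D.lineal = ⊥)
    (hs : Submodule.span ℝ (D : Set F) = ⊤) (h : finrank ℝ F ≤ 1) : D.IsSimplexCone := by
  obtain ⟨b, hb⟩ := exists_basis_of_span_eq_top hs
  refine ⟨_, b, le_antisymm (fun y hy => ?_) (Submodule.span_le.2 ?_)⟩
  · rw [← b.sum_repr y]
    refine Submodule.sum_mem _ fun i _ =>
      (hull ℝ (Set.range b)).smul_mem ?_ (Submodule.subset_span ⟨i, rfl⟩)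
    by_contra! hneg
    have : Subsingleton (Fin (finrank ℝ F)) := Fin.subsingleton_iff_le_one.2 h
    have hy' : y = b.repr y i • b i := by
      conv_lhs => rw [← b.sum_repr y]
      exact Fintype.sum_subsingleton _ i
    have hmem : -b i ∈ D := by
      have h1 := D.smul_mem (neg_nonneg.2 (inv_lt_zero.2 hneg).le) hy
      rw [hy', smul_smul] at h1
      simpa [hneg.ne] using h1
    have : b i ∈ D.lineal := ⟨hb i, hmem⟩
    rw [hp] at this
    exact b.ne_zero i this
  · rintro _ ⟨j, rfl⟩
    exact hb j

theorem IsSimplexCone.isSimplicial {D : PointedCone ℝ F} (h : D.IsSimplexCone) :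
    D.IsSimplicial := by
  obtain ⟨n, b, rfl⟩ := h
  exact .hull (Set.finite_range b) b.linearIndependent.linearIndepOn_id

end Simplex

/-! ### The strictly convex case. -/

section StrictlyConvex

variable {E : Type*} [AddCommGroup E] [Module ℝ E] [FiniteDimensional ℝ E]
  [TopologicalSpace E] [IsTopologicalAddGroup E] [ContinuousSMul ℝ E] [T2Space E]
  {F : Type*} [AddCommGroup F] [Module ℝ F] [FiniteDimensional ℝ F]
  [TopologicalSpace F] [IsTopologicalAddGroup F] [ContinuousSMul ℝ F] [T2Space F]

theorem exists_sum_of_mem_minTensorProduct {C : PointedCone ℝ E} {D : PointedCone ℝ F}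
    {t : E ⊗[ℝ] F} (ht : t ∈ minTensorProduct C D) :
    ∃ (n : ℕ) (x : Fin n → E) (y : Fin n → F), (∀ i, x i ∈ C) ∧ (∀ i, y i ∈ D) ∧
      ∑ i, x i ⊗ₜ[ℝ] y i = t := by
  obtain ⟨n, a, z, rfl⟩ := Submodule.mem_span_set'.1 ht
  choose x hx y hy hxy using fun i => (z i).2
  refine ⟨n, fun i => (a i : ℝ) • x i, y, fun i => C.smul_mem (a i).2 (hx i), hy, ?_⟩
  refine Finset.sum_congr rfl fun i _ => ?_
  rw [← hxy i]
  rfl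

theorem isSimplexCone_of_isStrictlyConvexCone {C : PointedCone ℝ E} {D : PointedCone ℝ F}
    (hC : IsClosed (C : Set E)) (hCp : C.lineal = ⊥) (hCs : Submodule.span ℝ (C : Set E) = ⊤)
    (hD : IsClosed (D : Set F)) (hDp : D.lineal = ⊥) (hDs : Submodule.span ℝ (D : Set F) = ⊤)
    (hdim : finrank ℝ F ≤ finrank ℝ E) (hstrict : C.IsStrictlyConvexCone)
    (h : minTensorProduct C D = maxTensorProduct C D) : D.IsSimplexCone := by
  rcases le_or_gt (finrank ℝ F) 1 with hF | hF
  · exact isSimplexCone_of_finrank_le_one hDp hDs hF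
  obtain ⟨_, _, _, _⟩ := exists_topologicalSpace_of_finiteDimensional (Dual ℝ F)
  obtain ⟨u, hu, huC, hspan⟩ := exists_positive_injective_span_frontier_eq_top
    (C := dual (Dual.eval ℝ F) (D : Set F)) (D := C)
    (isClosed_dual_of_finiteDimensional _) hC (lineal_dual_eq_bot hDs) hCp
    (span_dual_eq_top hD hDp) hCs (by rwa [Subspace.dual_finrank_eq])
    (by rwa [Subspace.dual_finrank_eq])
  obtain ⟨b, hb⟩ := exists_basis_of_span_eq_top hspan
  obtain ⟨e, he⟩ := b.exists_predual_basis
  have hub (j) : C.IsExtremalDirection (u (b j)) :=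
    hstrict _ (hb j).2 fun h0 => b.ne_zero j (hu (h0.trans (map_zero u).symm))
  -- This is `u` as a tensor: pairing it with `φ ⊗ ψ` gives `φ (u ψ)`.
  let t : E ⊗[ℝ] F := ∑ j, u (b j) ⊗ₜ e j
  have ht : t ∈ minTensorProduct C D := by
    rw [h, mem_maxTensorProduct]
    intro φ hφ ψ hψ
    have : dualDistrib ℝ E F (φ ⊗ₜ ψ) t = φ (u ψ) := by
      conv_rhs => rw [← Basis.sum_dual he ψ]
      simp only [t, map_sum, dualDistrib_apply, map_smul, smul_eq_mul]
      exact Finset.sum_congr rfl fun _ _ => mul_comm _ _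
    rw [this]
    exact hφ (huC ψ hψ)
  obtain ⟨n, x, y, hx, hy, hxy⟩ := exists_sum_of_mem_minTensorProduct ht
  have hsum (j) : ∑ i, b j (y i) • x i = u (b j) := by
    have h1 := congrArg (fun s => TensorProduct.rid ℝ E (LinearMap.lTensor E (b j) s)) hxy
    simp only [t, map_sum, LinearMap.lTensor_tmul, TensorProduct.rid_tmul] at h1
    rw [h1]
    simp [he]
  have hbD (j) {z : F} (hz : z ∈ D) : 0 ≤ b j z := (hb j).1 hz
  have hprop (i j) (hpos : b j (y i) ≠ 0) : ∃ c : ℝ, x i = c • u (b j) := by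
    have hmem (k) : b j (y k) • x k ∈ C := C.smul_mem (hbD j (hy k)) (hx k)
    obtain ⟨c, -, hc⟩ := (hub j).2.2 (b j (y i) • x i) (hmem i)
      (∑ k ∈ Finset.univ.erase i, b j (y k) • x k) (Submodule.sum_mem _ fun k _ => hmem k)
      ((Finset.add_sum_erase _ _ (Finset.mem_univ i)).trans (hsum j))
    refine ⟨(b j (y i))⁻¹ * c, ?_⟩
    rw [mul_smul, ← hc, smul_smul, inv_mul_cancel₀ hpos, one_smul]
  have heD (j) : e j ∈ D := by
    obtain ⟨i, hi⟩ : ∃ i, b j (y i) • x i ≠ 0 := by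
      by_contra! hall
      exact (hub j).2.1 (by rw [← hsum j]; exact Finset.sum_eq_zero fun i _ => hall i)
    obtain ⟨hi1, hi2⟩ := smul_ne_zero_iff.1 hi
    -- Otherwise the nonzero `x i` would be a multiple of both `u (b j)` and `u (b k)`, against
    -- injectivity of `u` and independence of `b`.
    have hzero (k) (hk : k ≠ j) : b k (y i) = 0 := by
      by_contra hk0
      obtain ⟨c, hc⟩ := hprop i j hi1
      obtain ⟨d, hd⟩ := hprop i k hk0
      have h1 : c • b j = d • b k := hu (by rw [map_smul, map_smul, ← hc, ← hd])
      have h2 := congrArg (fun s => s (e j)) h1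
      simp only [LinearMap.smul_apply, he, if_neg hk, if_true, smul_eq_mul, mul_one,
        mul_zero] at h2
      rw [h2, zero_smul] at hc
      exact hi2 hc
    have h1 : y i = b j (y i) • e j := by
      conv_lhs => rw [← Basis.sum_predual he (y i)]
      exact Finset.sum_eq_single j (fun k _ hk => by rw [hzero k hk, zero_smul]) (by simp)
    have h2 := D.smul_mem (inv_nonneg.2 (hbD j (hy i))) (hy i)
    rwa [h1, smul_smul, map_smul, he, if_pos rfl, smul_eq_mul, mul_one,
      inv_mul_cancel₀ hi1, one_smul] at h2
  refine ⟨_, e, le_antisymm (fun z hz => ?_) (Submodule.span_le.2 ?_)⟩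
  · rw [← Basis.sum_predual he z]
    exact Submodule.sum_mem _ fun i _ =>
      (hull ℝ (Set.range e)).smul_mem (hbD i hz) (Submodule.subset_span ⟨i, rfl⟩)
  · rintro _ ⟨j, rfl⟩
    exact heD j

end StrictlyConvex

end PointedCone

end TensorProductsOfCones

/-- Here `Ep.lineal = ⊥` says that `Ep ∩ -Ep = {0}` (the cone is proper), and `IsReproducing` says
that `Ep - Ep` is the whole space (the cone is generating). -/
theorem theoremD
    {E : Type*} [AddCommGroup E] [Module ℝ E] [FiniteDimensional ℝ E]
    [TopologicalSpace E] [IsTopologicalAddGroup E] [ContinuousSMul ℝ E] [T2Space E]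
    {F : Type*} [AddCommGroup F] [Module ℝ F] [FiniteDimensional ℝ F]
    [TopologicalSpace F] [IsTopologicalAddGroup F] [ContinuousSMul ℝ F] [T2Space F]
    (Ep : PointedCone ℝ E) (Fp : PointedCone ℝ F)
    (hE_closed : IsClosed (Ep : Set E)) (hE_proper : Ep.lineal = ⊥)
    (hE_generating : Ep.toConvexCone.IsReproducing)
    (hF_closed : IsClosed (Fp : Set F)) (hF_proper : Fp.lineal = ⊥)
    (hF_generating : Fp.toConvexCone.IsReproducing)
    (hdim : Module.finrank ℝ F ≤ Module.finrank ℝ E)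
    (hE : Ep.IsStrictlyConvexCone ∨ Ep.IsSmoothCone) :
    PointedCone.minTensorProduct Ep Fp = PointedCone.maxTensorProduct Ep Fp ↔
      Fp.IsSimplexCone := by
  have hEs : Submodule.span ℝ (Ep : Set E) = ⊤ := hE_generating.span_eq_top
  have hFs : Submodule.span ℝ (Fp : Set F) = ⊤ := hF_generating.span_eq_top
  constructor
  · intro h
    rcases hE with hE | hE
    · exact PointedCone.isSimplexCone_of_isStrictlyConvexCone hE_closed hE_proper hEs hF_closed
        hF_proper hFs hdim hE h
    · obtain ⟨_, _, _, _⟩ := exists_topologicalSpace_of_finiteDimensional (Module.Dual ℝ E)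
      obtain ⟨_, _, _, _⟩ := exists_topologicalSpace_of_finiteDimensional (Module.Dual ℝ F)
      refine PointedCone.IsSimplexCone.of_dual hF_closed ?_
      exact PointedCone.isSimplexCone_of_isStrictlyConvexCone
        (PointedCone.isClosed_dual_of_finiteDimensional _) (PointedCone.lineal_dual_eq_bot hEs)
        (PointedCone.span_dual_eq_top hE_closed hE_proper)
        (PointedCone.isClosed_dual_of_finiteDimensional _) (PointedCone.lineal_dual_eq_bot hFs)
        (PointedCone.span_dual_eq_top hF_closed hF_proper)
        (by rwa [Subspace.dual_finrank_eq, Subspace.dual_finrank_eq])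
        (hE.isStrictlyConvexCone_dual hE_closed hE_proper hEs)
        (PointedCone.minTensorProduct_dual_eq_maxTensorProduct_dual hEs hFs h)
  · intro h
    have : LocallyConvexSpace ℝ E := .of_finiteDimensional
    exact PointedCone.minTensorProduct_eq_max_of_simplicial_generating_right
      (⟨Ep, hE_closed⟩ : ProperCone ℝ E) Fp h.isSimplicial hFs
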